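/- Let $\Theta$ be a Borel subset of a Polish space with its Borel $\sigma$-algebra $\mathcal B(\Theta)$, let $\mu$ be a $\sigma$-finite measure on $\Theta$, and let $\mathbb G$ be a stochastic (Markov) kernel on $\Theta$ such that for each $\ell\in\Theta$ the measure $\mathbb G(\ell,\cdot)$ has a density $g(\ell,\cdot)\ge 0$ with respect to $\mu$. Let $\mathcal H_\infty^{n\times m}$ be the space of measurable $Q:\Theta\to\mathbb R^{n\times m}$ with $\operatorname{ess\,sup}_\mu\|Q(\ell)\|<\infty$ (spectral norm), and let $\mathcal H_\infty^{n+}$ be the set of those $U\in\mathcal H_\infty^{n\times n}$ with symmetric values and with $U(\ell)$ positive semidefinite for $\mu$-a.e. $\ell$. For $A,U\in\mathcal H_\infty^{n\times n}$ put $$\mathcal T_A(U)(\ell)=A(\ell)^T\Big(\int_\Theta g(\ell,t)\,U(t)\,\mu(dt)\Big)A(\ell).$$ For $A\in\mathcal H_\infty^{n\times n}$, the Markov jump linear system $(A|\mathbb G)$, $$x(k+1)=A(\vartheta(k))\,x(k),\quad x(0)=x_0,\quad k=0,1,2,\dots,$$ is called exponentially mean-square stable (EMSS) if there exist $\beta\ge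 1$ and $\alpha\in(0,1)$ such that $$\mathbf E\|x(k)\|^2\le\beta\alpha^k\|x_0\|^2\quad\text{for all } k\ge 0,$$ for every deterministic $x_0\in\mathbb R^n$ and every Markov chain $\{\vartheta(k)\}_{k\ge0}$ in $\Theta$ with transition kernel $\mathbb G$ whose initial distribution is absolutely continuous with respect to $\mu$. Let $A\in\mathcal H_\infty^{n\times n}$ and $C\in\mathcal H_\infty^{p\times n}$, and suppose that $(A;C|\mathbb G)$ is detectable, i.e. there exists $H\in\mathcal H_\infty^{n\times p}$ such that $(A+HC|\mathbb G)$ is EMSS. Then $(A|\mathbb G)$ is EMSS if and only if there exists $U\in\mathcal H_\infty^{n+}$ such that $$U(\ell)-\mathcal T_A(U)(\ell)=C(\ell)^TC(\ell)\qquad\text{for }\mu\text{-a.e. }\ell\in\Theta.$$ -/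

import Mathlib

open MeasureTheory ProbabilityTheory
open scoped NNReal ENNReal Matrix Matrix.Norms.L2Operator

namespace MJLS

universe u

section Functions

variable {Θ : Type u} [MeasurableSpace Θ] {n m : ℕ}

/-- The space of essentially bounded measurable matrix-valued functions: `Q` is (entrywise)
measurable and the `μ`-essential supremum of its spectral norm is finite. The matrix norm in force is the
operator norm induced by the Euclidean norms. -/
def MemHInf (μ : Measure Θ) (Q : Θ → Matrix (Fin n) (Fin m) ℝ) : Prop :=
  (∀ i j, Measurable fun ℓ => Q ℓ i j) ∧ essSup (fun ℓ => ‖Q ℓ‖ₑ) μ < ∞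

/-- The cone of essentially bounded measurable functions with values in the symmetric matrices
that are positive semidefinite `μ`-almost everywhere. -/
def MemHInfPos (μ : Measure Θ) (Q : Θ → Matrix (Fin n) (Fin n) ℝ) : Prop :=
  MemHInf μ Q ∧ (∀ ℓ, (Q ℓ).IsSymm) ∧ ∀ᵐ ℓ ∂μ, (Q ℓ).PosSemidef

/-- The averaging operator `U ↦ (ℓ ↦ ∫ g(ℓ, t) U(t) μ(dt))`, the integral of a matrix-valued
function being taken entrywise. -/
noncomputable def opE (μ : Measure Θ) (g : Θ → Θ → ℝ≥0) (U : Θ → Matrix (Fin n) (Fin n) ℝ) :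
    Θ → Matrix (Fin n) (Fin n) ℝ :=
  fun ℓ => Matrix.of fun i j => ∫ t, (g ℓ t : ℝ) * U t i j ∂μ

/-- The operator `U ↦ (ℓ ↦ Q(ℓ)ᵀ (∫ g(ℓ, t) U(t) μ(dt)) Q(ℓ))`. -/
noncomputable def opT (μ : Measure Θ) (g : Θ → Θ → ℝ≥0) (Q U : Θ → Matrix (Fin n) (Fin n) ℝ) :
    Θ → Matrix (Fin n) (Fin n) ℝ :=
  fun ℓ => (Q ℓ)ᵀ * opE μ g U ℓ * Q ℓ

/-- The solution of `x(k+1) = A(θ(k)) x(k)`, `x(0) = x₀`, along a path `θ` of modes. -/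
noncomputable def state (A : Θ → Matrix (Fin n) (Fin n) ℝ) (x₀ : EuclideanSpace ℝ (Fin n))
    (θ : ℕ → Θ) : ℕ → EuclideanSpace ℝ (Fin n)
  | 0 => x₀
  | k + 1 => WithLp.toLp 2 (A (θ k) *ᵥ (state A x₀ θ k).ofLp)

end Functions

/-- `θ` is a Markov chain on `(Ω, P)` with transition kernel `G`: given the past
`σ(θ(0), …, θ(k))`, the conditional probability of `θ(k+1) ∈ Λ` is `G(θ(k), Λ)` a.s. -/
structure IsMarkovChain {Θ Ω : Type u} [MeasurableSpace Θ] [MeasurableSpace Ω]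
    (G : Kernel Θ Θ) (P : Measure Ω) (θ : ℕ → Ω → Θ) : Prop where
  measurable : ∀ k, Measurable (θ k)
  markov : ∀ (k : ℕ) (Λ : Set Θ), MeasurableSet Λ →
    P⟦θ (k + 1) ⁻¹' Λ | ⨆ i ≤ k, MeasurableSpace.comap (θ i) inferInstance⟧
      =ᵐ[P] fun ω => (G (θ k ω) Λ).toReal

section Stability

variable {Θ : Type u} [MeasurableSpace Θ] {n p : ℕ}

/-- Exponential mean-square stability of `x(k+1) = A(θ(k)) x(k)`: one pair `β ≥ 1`, `α ∈ (0,1)`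
serves all deterministic initial states `x₀` and all Markov chains with kernel `G` whose
initial law is absolutely continuous with respect to `μ`. The expectation is taken in `[0,∞]`. -/
def IsEMSS (μ : Measure Θ) (G : Kernel Θ Θ) (A : Θ → Matrix (Fin n) (Fin n) ℝ) : Prop :=
  ∃ β α : ℝ, 1 ≤ β ∧ 0 < α ∧ α < 1 ∧
    ∀ (Ω : Type u) [MeasurableSpace Ω] (P : Measure Ω) [IsProbabilityMeasure P]
      (θ : ℕ → Ω → Θ), IsMarkovChain G P θ → P.map (θ 0) ≪ μ →
      ∀ (x₀ : EuclideanSpace ℝ (Fin n)) (k : ℕ),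
        ∫⁻ ω, ENNReal.ofReal (‖state A x₀ (fun i => θ i ω) k‖ ^ 2) ∂P
          ≤ ENNReal.ofReal (β * α ^ k * ‖x₀‖ ^ 2)

/-- Detectability: some essentially bounded measurable output injection `H` makes
`x(k+1) = (A(θ(k)) + H(θ(k)) C(θ(k))) x(k)` exponentially mean-square stable. -/
def IsDetectable (μ : Measure Θ) (G : Kernel Θ Θ) (A : Θ → Matrix (Fin n) (Fin n) ℝ)
    (C : Θ → Matrix (Fin p) (Fin n) ℝ) : Prop :=
  ∃ H : Θ → Matrix (Fin n) (Fin p) ℝ, MemHInf μ H ∧ IsEMSS μ G (fun ℓ => A ℓ + H ℓ * C ℓ)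

end Stability

end MJLS

/-!
The second moments of a Markov jump linear system are governed by a deterministic operator. For a
cost `v(ℓ, x) ≥ 0`, let `costStep G A v (ℓ, x) = ∫ v(t, A(ℓ) x) G(ℓ, dt)` be the expected cost one
step later. By the Markov property, `E v(θ(k), x(k))` is the integral of the `k`-th iterate of `v`
against the law of `θ(0)` (`IsMarkovChain.lintegral_state`). Chains with arbitrary initial law exist
by the Ionescu-Tulcea theorem, so exponential mean-square stability says exactly that the iterates
of the cost `‖x‖²` are bounded by `M αᵏ ‖x‖²` for almost every mode (`isEMSS_iff`). On quadratic
costs `xᵀ U(ℓ) x` the operator `costStep` acts as `opT` on the matrices (`costStep_formCost`).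

If the system is stable, the iterates of `opT` on `CᵀC` decay geometrically, and their sum solves
the Lyapunov equation (`exists_solution_of_isEMSS`).

Conversely, let `U ≥ 0` solve the equation, and let `A + HC` be stable. The total cost
`p = ∑ E‖x(k)‖²` of the stable closed loop satisfies `p = ‖x‖² + costStep G (A + HC) p`. As
`A x = (A + HC) x - H C x`, the weighted triangle inequality
`p(x + y) ≤ (1 + ε) p(x) + (1 + 1/ε) p(y)` bounds `costStep G A p + (1 + ε) ‖x‖²` by
`(1 + ε) p + K ‖C x‖²`. The error term `K ‖C x‖²` is exactly the one-step decrease of `K U`. If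
`p ≤ M ‖x‖²` and `ε = 1 / M`, then `ε p ≤ ‖x‖²`, and so the cost `w = p + K U` decreases by at least
`ε ‖x‖²` in one step of the open loop. Since `w` is comparable to `‖x‖²`, the open loop is stable
(`isEMSS_of_solution`, `isEMSS_of_lyapunov`).

Costs take values in `[0, ∞]`, so that neither integrability nor convergence of series is at issue
before the bounds are established.
-/

namespace MJLS

universe u

/-! ### The one-step cost operator -/

section Step

variable {Θ : Type*} [MeasurableSpace Θ] {n : ℕ}

/-- The one-step cost operator of `x(k+1) = A(θ(k)) x(k)`: for a cost `v` depending on mode and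
state, `costStep G A v ℓ x` is the expected cost after one step from mode `ℓ` and state `x`. -/
noncomputable def costStep (G : Kernel Θ Θ) (A : Θ → Matrix (Fin n) (Fin n) ℝ)
    (v : Θ → (Fin n → ℝ) → ℝ≥0∞) : Θ → (Fin n → ℝ) → ℝ≥0∞ :=
  fun ℓ x => ∫⁻ t, v t (A ℓ *ᵥ x) ∂(G ℓ)

/-- The cost `‖x‖²`. -/
noncomputable def sqCost : Θ → (Fin n → ℝ) → ℝ≥0∞ := fun _ x => ENNReal.ofReal (x ⬝ᵥ x)

lemma measurable_sqCost : Measurable (Function.uncurry (sqCost : Θ → (Fin n → ℝ) → ℝ≥0∞)) := by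
  unfold sqCost dotProduct
  simp only [Function.uncurry_def]
  fun_prop

lemma measurable_mulVec {α : Type*} [MeasurableSpace α] {m : ℕ} {Q : α → Matrix (Fin m) (Fin n) ℝ}
    {x : α → Fin n → ℝ} (hQ : ∀ i j, Measurable fun a => Q a i j) (hx : Measurable x) :
    Measurable fun a => Q a *ᵥ x a := by
  refine measurable_pi_lambda _ fun i => ?_
  simp only [Matrix.mulVec, dotProduct]
  exact Finset.measurable_sum _ fun j _ => (hQ i j).mul (measurable_pi_apply j |>.comp hx)

variable {G : Kernel Θ Θ} {A : Θ → Matrix (Fin n) (Fin n) ℝ} {μ : Measure Θ}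
  {v w : Θ → (Fin n → ℝ) → ℝ≥0∞}

lemma measurable_costStep [IsSFiniteKernel G] (hA : ∀ i j, Measurable fun ℓ => A ℓ i j)
    (hv : Measurable (Function.uncurry v)) : Measurable (Function.uncurry (costStep G A v)) := by
  have h1 : Measurable fun p : (Θ × (Fin n → ℝ)) × Θ => v p.2 (A p.1.1 *ᵥ p.1.2) := by
    refine hv.comp (measurable_snd.prodMk (measurable_mulVec (fun i j => ?_) ?_))
    · exact (hA i j).comp (measurable_fst.comp measurable_fst)
    · exact measurable_snd.comp measurable_fst
  exact Measurable.lintegral_kernel_prod_right' (κ := G.comap Prod.fst measurable_fst) h1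

lemma measurable_costStep_iterate [IsSFiniteKernel G] (hA : ∀ i j, Measurable fun ℓ => A ℓ i j)
    (hv : Measurable (Function.uncurry v)) (k : ℕ) :
    Measurable (Function.uncurry ((costStep G A)^[k] v)) := by
  induction k with
  | zero => exact hv
  | succ k ih => rw [Function.iterate_succ_apply']; exact measurable_costStep hA ih

/-- Since `G ℓ ≪ μ`, inequalities between costs need only hold for `μ`-almost every mode. -/
lemma costStep_mono (hG : ∀ ℓ, G ℓ ≪ μ) (h : ∀ᵐ t ∂μ, ∀ x, v t x ≤ w t x) (ℓ : Θ)
    (x : Fin n → ℝ) : costStep G A v ℓ x ≤ costStep G A w ℓ x :=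
  by
  refine lintegral_mono_ae ?_
  filter_upwards [(hG ℓ).ae_le h] with t ht using ht _

lemma costStep_iterate_mono (hG : ∀ ℓ, G ℓ ≪ μ) (h : ∀ᵐ t ∂μ, ∀ x, v t x ≤ w t x) (k : ℕ) :
    ∀ᵐ t ∂μ, ∀ x, (costStep G A)^[k] v t x ≤ (costStep G A)^[k] w t x := by
  induction k with
  | zero => exact h
  | succ k ih =>
    simp only [Function.iterate_succ_apply']
    exact .of_forall fun ℓ x => costStep_mono hG ih ℓ x

lemma costStep_const_mul {c : ℝ≥0∞} (hc : c ≠ ∞) (v : Θ → (Fin n → ℝ) → ℝ≥0∞) (ℓ : Θ)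
    (x : Fin n → ℝ) :
    costStep G A (fun t y => c * v t y) ℓ x = c * costStep G A v ℓ x :=
  lintegral_const_mul' _ _ hc

lemma costStep_add (hv : Measurable (Function.uncurry v)) (w : Θ → (Fin n → ℝ) → ℝ≥0∞)
    (ℓ : Θ) (x : Fin n → ℝ) :
    costStep G A (fun t y => v t y + w t y) ℓ x = costStep G A v ℓ x + costStep G A w ℓ x :=
  lintegral_add_left (hv.comp measurable_prodMk_right) _

lemma costStep_tsum {V : ℕ → Θ → (Fin n → ℝ) → ℝ≥0∞}
    (hV : ∀ k, Measurable (Function.uncurry (V k))) (ℓ : Θ)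
    (x : Fin n → ℝ) :
    costStep G A (fun t y => ∑' k, V k t y) ℓ x = ∑' k, costStep G A (V k) ℓ x :=
  lintegral_tsum fun k => ((hV k).comp measurable_prodMk_right).aemeasurable

/-- A cost that contracts by the factor `α` in one step contracts by `α ^ k` in `k` steps. -/
lemma costStep_iterate_le_of_contraction (hG : ∀ ℓ, G ℓ ≪ μ) {α : ℝ≥0∞} (hα : α ≠ ∞)
    (h : ∀ᵐ t ∂μ, ∀ x, costStep G A v t x ≤ α * v t x) (k : ℕ) :
    ∀ᵐ t ∂μ, ∀ x, (costStep G A)^[k] v t x ≤ α ^ k * v t x := by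
  induction k with
  | zero => exact .of_forall fun t x => by simp
  | succ k ih =>
    filter_upwards [h] with t ht x
    rw [Function.iterate_succ_apply']
    calc _ ≤ costStep G A (fun t y => α ^ k * v t y) t x := costStep_mono hG ih t x
      _ = α ^ k * costStep G A v t x := costStep_const_mul (ENNReal.pow_ne_top hα) _ _ _
      _ ≤ α ^ k * (α * v t x) := by gcongr; exact ht x
      _ = α ^ (k + 1) * v t x := by rw [pow_succ, mul_assoc]

end Step

/-! ### Quadratically homogeneous costs -/

section Quad

variable {Θ : Type*} {n : ℕ}

/-- The two properties of a squared Hilbert seminorm that the argument uses: homogeneity of degree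
two, and the weighted triangle inequality. -/
structure IsQuadLike (f : (Fin n → ℝ) → ℝ≥0∞) : Prop where
  smul : ∀ (a : ℝ) x, f (a • x) = ENNReal.ofReal (a ^ 2) * f x
  add_le : ∀ (ε : ℝ), 0 < ε → ∀ x y,
    f (x + y) ≤ ENNReal.ofReal (1 + ε) * f x + ENNReal.ofReal (1 + ε⁻¹) * f y

lemma isQuadLike_sqCost (ℓ : Θ) : IsQuadLike (sqCost (n := n) ℓ) where
  smul a x := by
    simp only [sqCost]
    rw [← ENNReal.ofReal_mul (sq_nonneg a)]
    simp only [smul_dotProduct, dotProduct_smul, smul_eq_mul]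
    ring_nf
  add_le ε hε x y := by
    have hx : 0 ≤ x ⬝ᵥ x := Finset.sum_nonneg fun i _ => mul_self_nonneg _
    have hy : 0 ≤ y ⬝ᵥ y := Finset.sum_nonneg fun i _ => mul_self_nonneg _
    simp only [sqCost]
    rw [← ENNReal.ofReal_mul (by positivity), ← ENNReal.ofReal_mul (by positivity),
      ← ENNReal.ofReal_add (by positivity) (by positivity)]
    apply ENNReal.ofReal_le_ofReal
    simp only [dotProduct, Finset.mul_sum, ← Finset.sum_add_distrib]
    refine Finset.sum_le_sum fun i _ => ?_
    have h2 : 0 ≤ ε⁻¹ * (ε * x i - y i) ^ 2 := by positivity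
    have h3 : ε⁻¹ * (ε * x i - y i) ^ 2
        = ε * (x i * x i) - 2 * (x i * y i) + ε⁻¹ * (y i * y i) := by
      field_simp
      ring
    simp only [Pi.add_apply]
    linarith

variable [MeasurableSpace Θ]

lemma IsQuadLike.costStep {G : Kernel Θ Θ} {A : Θ → Matrix (Fin n) (Fin n) ℝ}
    {v : Θ → (Fin n → ℝ) → ℝ≥0∞} (hm : Measurable (Function.uncurry v))
    (hv : ∀ t, IsQuadLike (v t)) (ℓ : Θ) : IsQuadLike (costStep G A v ℓ) where
  smul a x := by
    simp only [MJLS.costStep, Matrix.mulVec_smul, (hv _).smul]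
    exact lintegral_const_mul' _ _ ENNReal.ofReal_ne_top
  add_le ε hε x y := by
    simp only [MJLS.costStep, Matrix.mulVec_add]
    rw [← lintegral_const_mul' _ _ ENNReal.ofReal_ne_top,
      ← lintegral_const_mul' _ _ ENNReal.ofReal_ne_top,
      ← lintegral_add_left (Measurable.const_mul
        (f := fun t => v t (A ℓ *ᵥ x)) (hm.comp measurable_prodMk_right) _)]
    exact lintegral_mono fun t => (hv t).add_le ε hε _ _

lemma isQuadLike_costStep_iterate {G : Kernel Θ Θ} [IsSFiniteKernel G]
    {A : Θ → Matrix (Fin n) (Fin n) ℝ} (hA : ∀ i j, Measurable fun ℓ => A ℓ i j) (k : ℕ) (ℓ : Θ) :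
    IsQuadLike ((MJLS.costStep G A)^[k] sqCost ℓ) := by
  induction k generalizing ℓ with
  | zero => exact isQuadLike_sqCost ℓ
  | succ k ih =>
    rw [Function.iterate_succ_apply']
    exact IsQuadLike.costStep (measurable_costStep_iterate hA measurable_sqCost k) ih ℓ

lemma IsQuadLike.tsum {f : ℕ → (Fin n → ℝ) → ℝ≥0∞} (hf : ∀ k, IsQuadLike (f k)) :
    IsQuadLike fun x => ∑' k, f k x where
  smul a x := by simp only [(hf _).smul, ENNReal.tsum_mul_left]
  add_le ε hε x y := by
    rw [← ENNReal.tsum_mul_left, ← ENNReal.tsum_mul_left, ← ENNReal.tsum_add]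
    exact ENNReal.tsum_le_tsum fun k => (hf k).add_le ε hε x y

lemma IsQuadLike.map_zero {f : (Fin n → ℝ) → ℝ≥0∞} (hf : IsQuadLike f) : f 0 = 0 := by
  simpa using hf.smul 0 0

/-- Bounds of a quadratically homogeneous cost on the standard basis vectors give a bound on all
vectors, with a constant that depends on the dimension alone. -/
lemma IsQuadLike.le_of_basis {f : (Fin n → ℝ) → ℝ≥0∞} (hf : IsQuadLike f) {c : ℝ≥0∞}
    (h : ∀ i, f (Pi.single i 1) ≤ c) (x : Fin n → ℝ) :
    f x ≤ 2 ^ n * c * ENNReal.ofReal (x ⬝ᵥ x) := by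
  have key : ∀ s : Finset (Fin n), f (∑ i ∈ s, x i • Pi.single i (1 : ℝ))
      ≤ 2 ^ s.card * c * ∑ i ∈ s, ENNReal.ofReal (x i * x i) := by
    intro s
    induction s using Finset.induction_on with
    | empty => simp [hf.map_zero]
    | insert a s ha ih =>
      rw [Finset.sum_insert ha, Finset.sum_insert ha, Finset.card_insert_of_notMem ha]
      refine (hf.add_le 1 one_pos _ _).trans ?_
      have e2 : ENNReal.ofReal (1 + 1) = 2 := by norm_num
      rw [inv_one, e2, hf.smul, sq, mul_add]
      have h1 : (1 : ℝ≥0∞) ≤ 2 ^ s.card := one_le_pow₀ (by norm_num)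
      refine add_le_add ?_ ?_
      · calc _ ≤ 2 * (ENNReal.ofReal (x a * x a) * c) := by gcongr; exact h a
          _ = 1 * (2 * c * ENNReal.ofReal (x a * x a)) := by ring
          _ ≤ 2 ^ s.card * (2 * c * ENNReal.ofReal (x a * x a)) := by gcongr
          _ = _ := by ring
      · calc _ ≤ 2 * (2 ^ s.card * c * ∑ i ∈ s, ENNReal.ofReal (x i * x i)) := by gcongr
          _ = _ := by ring
  have := key Finset.univ
  rw [← ENNReal.ofReal_sum_of_nonneg fun i _ => mul_self_nonneg _] at this
  have hx : ∑ i, x i • Pi.single i (1 : ℝ) = x := by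
    ext j
    simp [Finset.sum_apply, Pi.single_apply]
  rwa [Finset.card_univ, Fintype.card_fin, hx] at this

end Quad

/-! ### Markov chains with a given kernel -/

section Chain

variable {Θ Ω : Type u} [MeasurableSpace Θ]

/-- The σ-algebra generated by `θ 0, …, θ k`. -/
abbrev pastAlgebra (θ : ℕ → Ω → Θ) (k : ℕ) : MeasurableSpace Ω :=
  ⨆ i ≤ k, MeasurableSpace.comap (θ i) inferInstance

lemma measurable_pastAlgebra (θ : ℕ → Ω → Θ) {i k : ℕ} (h : i ≤ k) :
    Measurable[pastAlgebra θ k] (θ i) :=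
  Measurable.mono (comap_measurable (θ i))
    (le_iSup₂_of_le (f := fun i (_ : i ≤ k) => MeasurableSpace.comap (θ i) _) i h le_rfl) le_rfl

/-- The state at time `k + 1` depends on the modes up to time `k` only. -/
lemma measurable_state {n : ℕ} {A : Θ → Matrix (Fin n) (Fin n) ℝ}
    (hA : ∀ i j, Measurable fun ℓ => A ℓ i j) (x₀ : EuclideanSpace ℝ (Fin n))
    (θ : ℕ → Ω → Θ) (k : ℕ) :
    Measurable[pastAlgebra θ k] fun ω => (state A x₀ (fun i => θ i ω) (k + 1)).ofLp := by
  induction k with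
  | zero =>
    exact @measurable_mulVec n Ω (pastAlgebra θ 0) n _ _
      (fun i j => (hA i j).comp (measurable_pastAlgebra θ le_rfl))
      (@measurable_const _ _ _ (pastAlgebra θ 0) x₀.ofLp)
  | succ k ih =>
    refine @measurable_mulVec n Ω (pastAlgebra θ (k + 1)) n _ _
      (fun i j => (hA i j).comp (measurable_pastAlgebra θ le_rfl)) (ih.mono ?_ le_rfl)
    exact iSup₂_mono' fun i hi => ⟨i, hi.trans (Nat.le_succ k), le_rfl⟩

variable [MeasurableSpace Ω] {n : ℕ}
  {G : Kernel Θ Θ} [IsMarkovKernel G] {P : Measure Ω} [IsProbabilityMeasure P] {θ : ℕ → Ω → Θ}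

lemma pastAlgebra_le (hθ : ∀ k, Measurable (θ k)) (k : ℕ) :
    pastAlgebra θ k ≤ ‹MeasurableSpace Ω› :=
  iSup₂_le fun i _ => (hθ i).comap_le

/-- The Markov property in integrated form: for `Y` depending on the past up to time `k`, the
conditional law of `θ (k + 1)` given `(θ k, Y)` is `G (θ k)`. -/
lemma IsMarkovChain.map_eq_compProd (h : IsMarkovChain G P θ) (k : ℕ) {E : Type*}
    [MeasurableSpace E] {Y : Ω → E} (hY : Measurable[pastAlgebra θ k] Y) :
    P.map (fun ω => ((θ k ω, Y ω), θ (k + 1) ω)) =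
      P.map (fun ω => (θ k ω, Y ω)) ⊗ₘ G.comap Prod.fst measurable_fst := by
  have hle := pastAlgebra_le h.measurable k
  have hZ : Measurable[pastAlgebra θ k] fun ω => (θ k ω, Y ω) :=
    (measurable_pastAlgebra θ le_rfl).prodMk hY
  have hZ' : Measurable fun ω => (θ k ω, Y ω) := hZ.mono hle le_rfl
  have hθ := h.measurable (k + 1)
  have : IsProbabilityMeasure (P.map fun ω => ((θ k ω, Y ω), θ (k + 1) ω)) :=
    Measure.isProbabilityMeasure_map (hZ'.prodMk hθ).aemeasurable
  have : IsProbabilityMeasure (P.map fun ω => (θ k ω, Y ω)) :=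
    Measure.isProbabilityMeasure_map hZ'.aemeasurable
  refine Measure.ext_prod fun {B} Λ hB hΛ => ?_
  have hS : MeasurableSet[pastAlgebra θ k] ((fun ω => (θ k ω, Y ω)) ⁻¹' B) := hZ hB
  have hGm : Measurable fun ω => G (θ k ω) Λ := (G.measurable_coe hΛ).comp (h.measurable k)
  rw [Measure.map_apply (hZ'.prodMk hθ) (hB.prod hΛ), Measure.compProd_apply_prod hB hΛ,
    setLIntegral_map hB (Kernel.measurable_coe _ hΛ) hZ']
  simp only [Kernel.comap_apply]
  have h1 : ∫ ω in (fun ω => (θ k ω, Y ω)) ⁻¹' B, (G (θ k ω) Λ).toReal ∂P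
      = P.real ((fun ω => (θ k ω, Y ω)) ⁻¹' B ∩ θ (k + 1) ⁻¹' Λ) := by
    rw [← setIntegral_congr_ae (hle _ hS) ((h.markov k Λ hΛ).mono fun ω hω _ => hω)]
    rw [setIntegral_condExp hle ((integrable_const (1 : ℝ)).indicator (hθ hΛ)) hS,
      setIntegral_indicator (hθ hΛ)]
    simp
  rw [integral_toReal hGm.aemeasurable (.of_forall fun ω => measure_lt_top _ _)] at h1
  have h2 : ∫⁻ ω in (fun ω => (θ k ω, Y ω)) ⁻¹' B, G (θ k ω) Λ ∂P ≠ ∞ := by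
    refine ((setLIntegral_mono measurable_const fun ω _ => prob_le_one).trans_lt ?_).ne
    simp
  rw [Measure.real, ENNReal.toReal_eq_toReal_iff' h2 (measure_ne_top _ _)] at h1
  exact h1.symm

lemma IsMarkovChain.lintegral_eq (h : IsMarkovChain G P θ) (k : ℕ) {E : Type*}
    [MeasurableSpace E] {Y : Ω → E} (hY : Measurable[pastAlgebra θ k] Y) {f : Θ → E → ℝ≥0∞}
    (hf : Measurable (Function.uncurry f)) :
    ∫⁻ ω, f (θ (k + 1) ω) (Y ω) ∂P = ∫⁻ ω, ∫⁻ t, f t (Y ω) ∂(G (θ k ω)) ∂P := by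
  have hle := pastAlgebra_le h.measurable k
  have hY' : Measurable Y := hY.mono hle le_rfl
  have hZ' : Measurable fun ω => (θ k ω, Y ω) := (h.measurable k).prodMk hY'
  have hF : Measurable fun p : (Θ × E) × Θ => f p.2 p.1.2 :=
    hf.comp (measurable_snd.prodMk (measurable_snd.comp measurable_fst))
  have : IsProbabilityMeasure (P.map fun ω => (θ k ω, Y ω)) :=
    Measure.isProbabilityMeasure_map hZ'.aemeasurable
  have e := congrArg (fun ν => ∫⁻ p, f p.2 p.1.2 ∂ν) (h.map_eq_compProd k hY)
  beta_reduce at e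
  rw [lintegral_map hF (hZ'.prodMk (h.measurable _)), Measure.lintegral_compProd hF,
    lintegral_map hF.lintegral_kernel_prod_right' hZ'] at e
  simpa using e

/-- The expected cost at time `k` along a Markov chain is obtained by iterating the one-step cost
operator. -/
lemma IsMarkovChain.lintegral_state (h : IsMarkovChain G P θ) {A : Θ → Matrix (Fin n) (Fin n) ℝ}
    (hA : ∀ i j, Measurable fun ℓ => A ℓ i j) (x₀ : EuclideanSpace ℝ (Fin n)) (k : ℕ)
    {v : Θ → (Fin n → ℝ) → ℝ≥0∞} (hv : Measurable (Function.uncurry v)) :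
    ∫⁻ ω, v (θ k ω) (state A x₀ (fun i => θ i ω) k).ofLp ∂P
      = ∫⁻ ℓ, (costStep G A)^[k] v ℓ x₀.ofLp ∂(P.map (θ 0)) := by
  induction k generalizing v with
  | zero =>
    exact (lintegral_map (f := fun ℓ => v ℓ x₀.ofLp) (hv.comp measurable_prodMk_right)
      (h.measurable 0)).symm
  | succ k ih =>
    rw [Function.iterate_succ_apply, ← ih (measurable_costStep hA hv),
      h.lintegral_eq k (measurable_state hA x₀ θ k) hv]
    rfl

end Chain

/-- For every initial law there is a Markov chain with kernel `G`: the coordinate process under the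
Ionescu-Tulcea measure. -/
lemma exists_isMarkovChain {Θ : Type u} [MeasurableSpace Θ] (G : Kernel Θ Θ) [IsMarkovKernel G]
    (ν : Measure Θ) [IsProbabilityMeasure ν] :
    ∃ P : Measure (ℕ → Θ), IsProbabilityMeasure P ∧
      IsMarkovChain G P (fun k ω => ω k) ∧ P.map (fun ω => ω 0) = ν := by
  let κ (k : ℕ) : Kernel ((i : Finset.Iic k) → Θ) Θ :=
    G.comap (fun x => x ⟨k, Finset.mem_Iic.2 le_rfl⟩) (measurable_pi_apply _)
  let P : Measure (ℕ → Θ) := Kernel.trajMeasure (X := fun _ => Θ) ν κ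
  have hP : IsProbabilityMeasure P := by infer_instance
  refine ⟨P, hP, ⟨fun k => measurable_pi_apply k, fun k Λ hΛ => ?_⟩, ?_⟩
  · have hle : pastAlgebra (fun (k : ℕ) (ω : ℕ → Θ) => ω k) k ≤ MeasurableSpace.pi :=
      pastAlgebra_le measurable_pi_apply k
    have hmeas : Measurable[pastAlgebra (fun (k : ℕ) (ω : ℕ → Θ) => ω k) k] fun ω : ℕ → Θ => ω k :=
      measurable_pastAlgebra (fun (k : ℕ) (ω : ℕ → Θ) => ω k) le_rfl
    have hG : StronglyMeasurable[pastAlgebra (fun (k : ℕ) (ω : ℕ → Θ) => ω k) k]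
        fun ω : ℕ → Θ => (G (ω k) Λ).toReal :=
      ((G.measurable_coe hΛ).ennreal_toReal.comp hmeas).stronglyMeasurable
    have hGint : Integrable (fun ω : ℕ → Θ => (G (ω k) Λ).toReal) P := by
      refine Integrable.of_bound (hG.mono hle).aestronglyMeasurable 1 (.of_forall fun ω => ?_)
      rw [Real.norm_of_nonneg ENNReal.toReal_nonneg]
      exact ENNReal.toReal_le_of_le_ofReal zero_le_one (by simpa using prob_le_one)
    symm
    refine ae_eq_condExp_of_forall_setIntegral_eq hle
      ((integrable_const (1 : ℝ)).indicator (measurable_pi_apply (k + 1) hΛ))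
      (fun s _ _ => hGint.integrableOn) (fun s hs _ => ?_) hG.aestronglyMeasurable
    -- Events of the past depend on the first `k + 1` coordinates only, and the joint law of these
    -- and the next coordinate is a composition-product with `κ k`.
    obtain ⟨B, hB, rfl⟩ : ∃ B, MeasurableSet B ∧
        Preorder.frestrictLe (π := fun _ => Θ) k ⁻¹' B = s := by
      have : pastAlgebra (fun (k : ℕ) (ω : ℕ → Θ) => ω k) k ≤
          MeasurableSpace.comap (Preorder.frestrictLe (π := fun _ => Θ) k) inferInstance := by
        refine iSup₂_le fun i hi => ?_
        change MeasurableSpace.comap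
          ((fun x : (j : Finset.Iic k) → Θ => x ⟨i, Finset.mem_Iic.2 hi⟩) ∘
            Preorder.frestrictLe (π := fun _ => Θ) k) _ ≤ _
        rw [← MeasurableSpace.comap_comp]
        exact MeasurableSpace.comap_mono (measurable_pi_apply _).comap_le
      exact this _ hs
    have hfr : Measurable (Preorder.frestrictLe (π := fun _ => Θ) k) :=
      Preorder.measurable_frestrictLe k
    have hlaw := congrArg (fun ρ => ρ (B ×ˢ Λ))
      (Kernel.map_frestrictLe_trajMeasure_compProd_eq_map_trajMeasure
        (μ₀ := ν) (X := fun _ => Θ) (κ := κ) (a := k))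
    beta_reduce at hlaw
    have : IsProbabilityMeasure ((Kernel.trajMeasure (X := fun _ => Θ) ν κ).map
      (Preorder.frestrictLe (π := fun _ => Θ) k)) :=
      Measure.isProbabilityMeasure_map hfr.aemeasurable
    rw [Measure.compProd_apply_prod hB hΛ, setLIntegral_map hB (Kernel.measurable_coe _ hΛ) hfr,
      Measure.map_apply (hfr.prodMk (measurable_pi_apply (k + 1))) (hB.prod hΛ)] at hlaw
    have hGm : Measurable fun ω : ℕ → Θ => G (ω k) Λ :=
      (G.measurable_coe hΛ).comp (measurable_pi_apply k)
    rw [integral_toReal hGm.aemeasurable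
      (.of_forall fun ω => measure_lt_top _ _),
      setIntegral_indicator (measurable_pi_apply (k + 1) hΛ)]
    simp only [integral_const, smul_eq_mul, mul_one, measureReal_restrict_apply_univ]
    rw [Measure.real]
    congr 1
  · have h0 : (fun ω : ℕ → Θ => ω 0) =
        (fun x : (j : Finset.Iic 0) → Θ => x ⟨0, Finset.mem_Iic.2 le_rfl⟩) ∘
          Preorder.frestrictLe (π := fun _ => Θ) 0 := rfl
    have hfr : Measurable (Preorder.frestrictLe (π := fun _ => Θ) 0) :=
      Preorder.measurable_frestrictLe 0
    rw [h0, ← Measure.map_map (measurable_pi_apply _) hfr]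
    simp only [P]
    rw [Kernel.trajMeasure, Measure.map_comp _ _ hfr, Kernel.traj_map_frestrictLe,
      Kernel.partialTraj_self]
    rw [Measure.id_comp, Measure.map_map (measurable_pi_apply _) (by fun_prop)]
    exact Measure.map_id

/-! ### Mean-square stability as decay of the iterated cost -/

lemma zero_le_dotProduct_self {n : ℕ} (x : Fin n → ℝ) : 0 ≤ x ⬝ᵥ x :=
  Finset.sum_nonneg fun _ _ => mul_self_nonneg _

lemma norm_sq_eq_dotProduct {n : ℕ} (x : EuclideanSpace ℝ (Fin n)) :
    ‖x‖ ^ 2 = x.ofLp ⬝ᵥ x.ofLp := by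
  rw [EuclideanSpace.real_norm_sq_eq]
  simp only [dotProduct, sq]

/-- Exponential mean-square stability means that the iterated costs decay geometrically for almost
every initial mode. Starting the chain from the normalized restrictions of `μ` to sets of finite
measure turns bounds in the mean into bounds almost everywhere. By homogeneity it suffices to do so
for the standard basis vectors, so the exceptional null set does not depend on the state. -/
theorem isEMSS_iff {Θ : Type u} [MeasurableSpace Θ] {μ : Measure Θ} [SigmaFinite μ]
    {G : Kernel Θ Θ} [IsMarkovKernel G] {n : ℕ} {A : Θ → Matrix (Fin n) (Fin n) ℝ}
    (hA : ∀ i j, Measurable fun ℓ => A ℓ i j) :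
    IsEMSS μ G A ↔ ∃ M α : ℝ, 0 ≤ M ∧ 0 < α ∧ α < 1 ∧ ∀ k, ∀ᵐ ℓ ∂μ, ∀ x,
      (costStep G A)^[k] sqCost ℓ x ≤ ENNReal.ofReal (M * α ^ k) * sqCost ℓ x := by
  constructor
  · rintro ⟨β, α, hβ, hα0, hα1, h⟩
    refine ⟨2 ^ n * β, α, by positivity, hα0, hα1, fun k => ?_⟩
    have hbasis : ∀ i : Fin n, ∀ᵐ ℓ ∂μ,
        (costStep G A)^[k] sqCost ℓ (Pi.single i 1) ≤ ENNReal.ofReal (β * α ^ k) := by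
      intro i
      have hm : Measurable fun ℓ => (costStep G A)^[k] sqCost ℓ (Pi.single i 1) :=
        (measurable_costStep_iterate (G := G) hA measurable_sqCost k).comp measurable_prodMk_right
      refine ae_le_of_forall_setLIntegral_le_of_sigmaFinite hm fun s hs hμs => ?_
      -- The test chain starts from the normalized restriction of `μ` to `s`.
      rcases eq_or_ne (μ s) 0 with h0 | h0
      · rw [setLIntegral_measure_zero _ _ h0]
        exact zero_le
      have hν : IsProbabilityMeasure (cond μ s) := cond_isProbabilityMeasure_of_finite h0 hμs.ne
      obtain ⟨P, hP, hchain, hlaw⟩ := exists_isMarkovChain G (cond μ s)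
      have hx : ‖(WithLp.toLp 2 (Pi.single i 1) : EuclideanSpace ℝ (Fin n))‖ ^ 2 = 1 := by
        rw [norm_sq_eq_dotProduct]
        simp
      have hb := h (ℕ → Θ) P (fun k ω => ω k) hchain (hlaw ▸ cond_absolutelyContinuous)
        (WithLp.toLp 2 (Pi.single i 1)) k
      rw [hx, mul_one] at hb
      have he := hchain.lintegral_state hA (WithLp.toLp 2 (Pi.single i 1)) k measurable_sqCost
      simp only [sqCost, ← norm_sq_eq_dotProduct] at he
      rw [he, hlaw, ProbabilityTheory.cond, lintegral_smul_measure, smul_eq_mul,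
        ENNReal.inv_mul_le_iff h0 hμs.ne] at hb
      rw [setLIntegral_const, mul_comm]
      exact hb
    filter_upwards [ae_all_iff.2 hbasis] with ℓ hℓ x
    refine ((isQuadLike_costStep_iterate hA k ℓ).le_of_basis hℓ x).trans_eq ?_
    rw [mul_assoc (2 ^ n : ℝ), ENNReal.ofReal_mul (p := 2 ^ n) (by positivity),
      ENNReal.ofReal_pow (by norm_num)]
    simp [sqCost]
  · rintro ⟨M, α, hM, hα0, hα1, h⟩
    refine ⟨max 1 M, α, le_max_left _ _, hα0, hα1, fun Ω _ P _ θ hθ h0 x₀ k => ?_⟩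
    have he := hθ.lintegral_state hA x₀ k measurable_sqCost
    simp only [sqCost, ← norm_sq_eq_dotProduct] at he
    rw [he]
    have : IsProbabilityMeasure (P.map (θ 0)) :=
      Measure.isProbabilityMeasure_map (hθ.measurable 0).aemeasurable
    calc _ ≤ ∫⁻ _, ENNReal.ofReal (max 1 M * α ^ k * ‖x₀‖ ^ 2) ∂(P.map (θ 0)) := by
          refine lintegral_mono_ae ?_
          filter_upwards [h0.ae_le (h k)] with ℓ hℓ
          refine (hℓ x₀.ofLp).trans ?_
          simp only [sqCost]
          rw [← ENNReal.ofReal_mul (by positivity), ← norm_sq_eq_dotProduct]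
          apply ENNReal.ofReal_le_ofReal
          gcongr
          exact le_max_right _ _
      _ = _ := by simp

/-! ### Essentially bounded matrix functions -/

section Bounds

variable {m n : ℕ}

lemma dotProduct_mulVec_self_le (M : Matrix (Fin m) (Fin n) ℝ) (x : Fin n → ℝ) :
    (M *ᵥ x) ⬝ᵥ (M *ᵥ x) ≤ ‖M‖ ^ 2 * (x ⬝ᵥ x) := by
  have h := M.l2_opNorm_mulVec (WithLp.toLp 2 x)
  have h2 := pow_le_pow_left₀ (norm_nonneg _) h 2
  rwa [mul_pow, norm_sq_eq_dotProduct, norm_sq_eq_dotProduct] at h2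

lemma abs_entry_le_norm (M : Matrix (Fin m) (Fin n) ℝ) (i : Fin m) (j : Fin n) :
    |M i j| ≤ ‖M‖ := by
  have h := dotProduct_mulVec_self_le M (Pi.single j 1)
  have h1 : (Pi.single j 1 : Fin n → ℝ) ⬝ᵥ Pi.single j 1 = 1 := by simp
  rw [Matrix.mulVec_single_one, h1, mul_one] at h
  refine abs_le_of_sq_le_sq (le_trans ?_ h) (norm_nonneg _)
  rw [sq]
  exact Finset.single_le_sum (f := fun i => M i j * M i j) (fun _ _ => mul_self_nonneg _)
    (Finset.mem_univ i)

/-- Entrywise bounds give bounds on the spectral norm, up to a constant depending only on the size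
of the matrix. -/
lemma norm_le_of_entry_le {K : ℝ} {M : Matrix (Fin m) (Fin n) ℝ} (h : ∀ i j, |M i j| ≤ K) :
    ‖M‖ ≤ K * ∑ i, ∑ j, ‖(Matrix.single i j 1 : Matrix (Fin m) (Fin n) ℝ)‖ := by
  conv_lhs => rw [Matrix.matrix_eq_sum_single M]
  rw [Finset.mul_sum]
  refine (norm_sum_le _ _).trans (Finset.sum_le_sum fun i _ => ?_)
  rw [Finset.mul_sum]
  refine (norm_sum_le _ _).trans (Finset.sum_le_sum fun j _ => ?_)
  rw [← mul_one (M i j), ← smul_eq_mul, ← Matrix.smul_single, norm_smul, Real.norm_eq_abs]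
  gcongr
  exact h i j

variable {Θ : Type*} [MeasurableSpace Θ] {μ : Measure Θ} {Q : Θ → Matrix (Fin m) (Fin n) ℝ}

lemma MemHInf.exists_norm_le (hQ : MemHInf μ Q) : ∃ K : ℝ, 0 ≤ K ∧ ∀ᵐ ℓ ∂μ, ‖Q ℓ‖ ≤ K := by
  refine ⟨(essSup (fun ℓ => ‖Q ℓ‖ₑ) μ).toReal, ENNReal.toReal_nonneg, ?_⟩
  filter_upwards [ENNReal.ae_le_essSup fun ℓ => ‖Q ℓ‖ₑ] with ℓ hℓ
  rw [← toReal_enorm]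
  exact ENNReal.toReal_mono hQ.2.ne hℓ

lemma memHInf_of_norm_le (hm : ∀ i j, Measurable fun ℓ => Q ℓ i j) {K : ℝ}
    (h : ∀ᵐ ℓ ∂μ, ‖Q ℓ‖ ≤ K) : MemHInf μ Q := by
  refine ⟨hm, (essSup_le_of_ae_le (ENNReal.ofReal K) ?_).trans_lt ENNReal.ofReal_lt_top⟩
  filter_upwards [h] with ℓ hℓ
  rw [← ofReal_norm]
  exact ENNReal.ofReal_le_ofReal hℓ

lemma memHInf_of_entry_le (hm : ∀ i j, Measurable fun ℓ => Q ℓ i j) {K : ℝ}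
    (h : ∀ᵐ ℓ ∂μ, ∀ i j, |Q ℓ i j| ≤ K) : MemHInf μ Q :=
  memHInf_of_norm_le hm (h.mono fun _ hℓ => norm_le_of_entry_le hℓ)

lemma norm_transpose (M : Matrix (Fin m) (Fin n) ℝ) : ‖Mᵀ‖ = ‖M‖ := by
  rw [← Matrix.l2_opNorm_conjTranspose M, Matrix.conjTranspose_eq_transpose_of_trivial]

lemma memHInfPos_transpose_mul_self (hQ : MemHInf μ Q) :
    MemHInfPos μ fun ℓ => (Q ℓ)ᵀ * Q ℓ := by
  obtain ⟨K, hK0, hK⟩ := hQ.exists_norm_le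
  refine ⟨memHInf_of_norm_le (K := K * K) (fun i j => ?_) ?_, fun ℓ => ?_, .of_forall fun ℓ => ?_⟩
  · simp only [Matrix.mul_apply, Matrix.transpose_apply]
    exact Finset.measurable_sum _ fun k _ => (hQ.1 k i).mul (hQ.1 k j)
  · filter_upwards [hK] with ℓ hℓ
    refine (Matrix.l2_opNorm_mul _ _).trans ?_
    rw [norm_transpose]
    gcongr
  · simp only [Matrix.IsSymm, Matrix.transpose_mul, Matrix.transpose_transpose]
  · beta_reduce
    rw [← Matrix.conjTranspose_eq_transpose_of_trivial]
    exact Matrix.posSemidef_conjTranspose_mul_self _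

lemma dotProduct_transpose_mul_mulVec (M : Matrix (Fin m) (Fin n) ℝ) (N : Matrix (Fin m) (Fin m) ℝ)
    (x : Fin n → ℝ) : x ⬝ᵥ (Mᵀ * N * M) *ᵥ x = (M *ᵥ x) ⬝ᵥ N *ᵥ (M *ᵥ x) := by
  rw [← Matrix.mulVec_mulVec, ← Matrix.mulVec_mulVec, Matrix.dotProduct_mulVec,
    Matrix.vecMul_transpose]

end Bounds

/-! ### Quadratic costs -/

section Form

variable {Θ : Type*} {n : ℕ}

/-- The quadratic cost `xᵀ Q(ℓ) x` of a matrix function. Negative values are truncated to `0`; the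
definition is applied to positive semidefinite values. -/
noncomputable def formCost (Q : Θ → Matrix (Fin n) (Fin n) ℝ) : Θ → (Fin n → ℝ) → ℝ≥0∞ :=
  fun ℓ x => ENNReal.ofReal (x ⬝ᵥ Q ℓ *ᵥ x)

variable [MeasurableSpace Θ] {μ : Measure Θ} {Q U : Θ → Matrix (Fin n) (Fin n) ℝ}

/-- An essentially bounded matrix function defines a cost bounded by a multiple of `‖x‖²`. -/
lemma MemHInf.exists_sqCost_bound {m : ℕ} {C : Θ → Matrix (Fin m) (Fin n) ℝ} (hC : MemHInf μ C) :
    ∃ K : ℝ, 0 ≤ K ∧ ∀ᵐ ℓ ∂μ, ∀ x : Fin n → ℝ,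
      ENNReal.ofReal ((C ℓ *ᵥ x) ⬝ᵥ (C ℓ *ᵥ x)) ≤ ENNReal.ofReal K * sqCost ℓ x := by
  obtain ⟨K, hK0, hK⟩ := hC.exists_norm_le
  refine ⟨K ^ 2, by positivity, ?_⟩
  filter_upwards [hK] with ℓ hℓ x
  simp only [sqCost]
  rw [← ENNReal.ofReal_mul (by positivity)]
  refine ENNReal.ofReal_le_ofReal ((dotProduct_mulVec_self_le _ _).trans ?_)
  gcongr
  exact zero_le_dotProduct_self x

lemma MemHInf.exists_formCost_bound (hU : MemHInf μ U) :
    ∃ K : ℝ, 0 ≤ K ∧ ∀ᵐ ℓ ∂μ, ∀ x, formCost U ℓ x ≤ ENNReal.ofReal K * sqCost ℓ x := by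
  obtain ⟨K, hK0, hK⟩ := hU.exists_norm_le
  refine ⟨1 + K ^ 2, by positivity, ?_⟩
  filter_upwards [hK] with ℓ hℓ x
  simp only [sqCost, formCost]
  rw [← ENNReal.ofReal_mul (by positivity)]
  refine ENNReal.ofReal_le_ofReal ?_
  have hx := zero_le_dotProduct_self x
  have h1 : (U ℓ *ᵥ x) ⬝ᵥ (U ℓ *ᵥ x) ≤ K ^ 2 * (x ⬝ᵥ x) := by
    refine (dotProduct_mulVec_self_le _ _).trans ?_
    gcongr
  have h2 := zero_le_dotProduct_self (x - U ℓ *ᵥ x)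
  have h3 := zero_le_dotProduct_self (U ℓ *ᵥ x)
  simp only [sub_dotProduct, dotProduct_sub] at h2
  rw [dotProduct_comm (U ℓ *ᵥ x) x] at h2
  linarith

/-- A positive semidefinite matrix whose quadratic form is at most `K ‖x‖²` has entries at most
`K`. -/
lemma abs_entry_le_of_form_le {M : Matrix (Fin n) (Fin n) ℝ} (hM : M.PosSemidef) {K : ℝ}
    (h : ∀ x, x ⬝ᵥ M *ᵥ x ≤ K * (x ⬝ᵥ x)) (i j : Fin n) : |M i j| ≤ K := by
  have hs : M j i = M i j := by simpa using hM.isHermitian.apply i j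
  have hd : ∀ i, M i i ≤ K := fun i => by simpa using h (Pi.single i 1)
  have hp := hM.dotProduct_mulVec_nonneg (Pi.single i 1 + Pi.single j 1)
  have hq := hM.dotProduct_mulVec_nonneg (Pi.single i 1 - Pi.single j 1)
  simp [Matrix.mulVec_add, Matrix.mulVec_sub] at hp hq
  have := hd i
  have := hd j
  rw [abs_le]
  constructor <;> linarith

variable {G : Kernel Θ Θ} {g : Θ → Θ → ℝ≥0} {A : Θ → Matrix (Fin n) (Fin n) ℝ}

lemma opE_apply_eq_integral (hg_meas : ∀ ℓ, Measurable (g ℓ))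
    (hg : ∀ ℓ, G ℓ = μ.withDensity fun t => (g ℓ t : ℝ≥0∞)) (ℓ : Θ) (i j : Fin n) :
    opE μ g U ℓ i j = ∫ t, U t i j ∂(G ℓ) := by
  rw [hg, integral_withDensity_eq_integral_smul (hg_meas ℓ)]
  rfl

lemma MemHInf.integrable_entry [IsMarkovKernel G] (hG : ∀ ℓ, G ℓ ≪ μ) (hU : MemHInf μ U) (ℓ : Θ)
    (i j : Fin n) : Integrable (fun t => U t i j) (G ℓ) := by
  obtain ⟨K, -, hK⟩ := hU.exists_norm_le
  refine Integrable.of_bound (hU.1 i j).aestronglyMeasurable K ?_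
  filter_upwards [(hG ℓ).ae_le hK] with t ht
  exact (abs_entry_le_norm _ i j).trans ht

lemma dotProduct_opE [IsMarkovKernel G] (hG : ∀ ℓ, G ℓ ≪ μ) (hg_meas : ∀ ℓ, Measurable (g ℓ))
    (hg : ∀ ℓ, G ℓ = μ.withDensity fun t => (g ℓ t : ℝ≥0∞)) (hU : MemHInf μ U) (ℓ : Θ)
    (y : Fin n → ℝ) :
    Integrable (fun t => y ⬝ᵥ U t *ᵥ y) (G ℓ) ∧
      y ⬝ᵥ opE μ g U ℓ *ᵥ y = ∫ t, y ⬝ᵥ U t *ᵥ y ∂(G ℓ) := by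
  have hi : ∀ i j, Integrable (fun t => y i * (U t i j * y j)) (G ℓ) := fun i j =>
    ((hU.integrable_entry hG ℓ i j).mul_const _).const_mul _
  simp only [dotProduct, Matrix.mulVec, Finset.mul_sum]
  refine ⟨integrable_finsetSum _ fun i _ => integrable_finsetSum _ fun j _ => hi i j, ?_⟩
  rw [integral_finsetSum _ fun i _ => integrable_finsetSum _ fun j _ => hi i j]
  refine Finset.sum_congr rfl fun i _ => ?_
  rw [integral_finsetSum _ fun j _ => hi i j]
  refine Finset.sum_congr rfl fun j _ => ?_
  rw [integral_const_mul, integral_mul_const, opE_apply_eq_integral hg_meas hg]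

/-- On quadratic costs the one-step cost operator acts as `opT` on the matrices. -/
lemma costStep_formCost [IsMarkovKernel G] (hG : ∀ ℓ, G ℓ ≪ μ)
    (hg_meas : ∀ ℓ, Measurable (g ℓ)) (hg : ∀ ℓ, G ℓ = μ.withDensity fun t => (g ℓ t : ℝ≥0∞))
    (hU : MemHInfPos μ U) (ℓ : Θ) (x : Fin n → ℝ) :
    costStep G A (formCost U) ℓ x = formCost (opT μ g A U) ℓ x := by
  obtain ⟨h1, h2⟩ := dotProduct_opE hG hg_meas hg hU.1 ℓ (A ℓ *ᵥ x)
  simp only [costStep, formCost, opT]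
  rw [dotProduct_transpose_mul_mulVec, h2, ofReal_integral_eq_lintegral_ofReal h1]
  filter_upwards [(hG ℓ).ae_le hU.2.2] with t ht
  simpa using ht.dotProduct_mulVec_nonneg (A ℓ *ᵥ x)

lemma MemHInfPos.opT [IsMarkovKernel G] (hG : ∀ ℓ, G ℓ ≪ μ) (hg_meas : ∀ ℓ, Measurable (g ℓ))
    (hg : ∀ ℓ, G ℓ = μ.withDensity fun t => (g ℓ t : ℝ≥0∞)) (hA : MemHInf μ A)
    (hU : MemHInfPos μ U) : MemHInfPos μ (opT μ g A U) := by
  obtain ⟨K, hK0, hK⟩ := hU.1.exists_norm_le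
  obtain ⟨L, hL0, hL⟩ := hA.exists_norm_le
  have hEm : ∀ i j, Measurable fun ℓ => opE μ g U ℓ i j := by
    intro i j
    simp only [opE_apply_eq_integral hg_meas hg]
    exact ((hU.1.1 i j).stronglyMeasurable.integral_kernel).measurable
  have hEb : ∀ ℓ i j, |opE μ g U ℓ i j| ≤ K := by
    intro ℓ i j
    rw [opE_apply_eq_integral hg_meas hg, ← Real.norm_eq_abs]
    refine (norm_integral_le_of_norm_le_const (C := K) ?_).trans_eq (by simp)
    filter_upwards [(hG ℓ).ae_le hK] with t ht
    exact (abs_entry_le_norm _ i j).trans ht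
  have hEs : ∀ ℓ, (opE μ g U ℓ).IsSymm := by
    intro ℓ
    ext i j
    simp only [Matrix.transpose_apply, opE_apply_eq_integral hg_meas hg, (hU.2.1 _).apply]
  have hTs : ∀ ℓ, (MJLS.opT μ g A U ℓ).IsSymm := by
    intro ℓ
    simp only [Matrix.IsSymm, MJLS.opT, Matrix.transpose_mul, Matrix.transpose_transpose,
      (hEs ℓ).eq, Matrix.mul_assoc]
  refine ⟨memHInf_of_norm_le
    (K := L * (K * ∑ i, ∑ j, ‖(Matrix.single i j 1 : Matrix (Fin n) (Fin n) ℝ)‖) * L)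
    (fun i j => ?_) ?_, hTs, .of_forall fun ℓ => ?_⟩
  · simp only [MJLS.opT, Matrix.mul_apply, Matrix.transpose_apply]
    exact Finset.measurable_sum _ fun k _ =>
      (Finset.measurable_sum _ fun k' _ => (hA.1 _ _).mul (hEm _ _)).mul (hA.1 _ _)
  · filter_upwards [hL] with ℓ hℓ
    refine (Matrix.l2_opNorm_mul _ _).trans ?_
    have h1 := norm_le_of_entry_le (hEb ℓ)
    have h2 : ‖(A ℓ)ᵀ * opE μ g U ℓ‖ ≤
        L * (K * ∑ i, ∑ j, ‖(Matrix.single i j 1 : Matrix (Fin n) (Fin n) ℝ)‖) := by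
      refine (Matrix.l2_opNorm_mul _ _).trans ?_
      rw [norm_transpose]
      gcongr
    gcongr
  · refine .of_dotProduct_mulVec_nonneg ?_ fun x => ?_
    · rw [Matrix.IsHermitian, Matrix.conjTranspose_eq_transpose_of_trivial]
      exact hTs ℓ
    · rw [star_trivial, MJLS.opT, dotProduct_transpose_mul_mulVec,
        (dotProduct_opE hG hg_meas hg hU.1 ℓ _).2]
      refine integral_nonneg_of_ae ?_
      filter_upwards [(hG ℓ).ae_le hU.2.2] with t ht
      simpa using ht.dotProduct_mulVec_nonneg (A ℓ *ᵥ x)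

end Form

/-! ### Stability gives a solution of the Lyapunov equation -/

section Sum

variable {Θ : Type*} [MeasurableSpace Θ] {μ : Measure Θ} {n : ℕ} {G : Kernel Θ Θ}
  {g : Θ → Θ → ℝ≥0} {A Q : Θ → Matrix (Fin n) (Fin n) ℝ}

lemma costStep_iterate_const_mul {c : ℝ≥0∞} (hc : c ≠ ∞) (v : Θ → (Fin n → ℝ) → ℝ≥0∞) (k : ℕ) :
    (costStep G A)^[k] (fun t y => c * v t y) = fun t y => c * (costStep G A)^[k] v t y := by
  induction k with
  | zero => rfl
  | succ k ih =>
    rw [Function.iterate_succ_apply', ih, Function.iterate_succ_apply']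
    funext ℓ x
    exact costStep_const_mul hc _ ℓ x

variable [IsMarkovKernel G]

lemma memHInfPos_opT_iterate (hG : ∀ ℓ, G ℓ ≪ μ) (hg_meas : ∀ ℓ, Measurable (g ℓ))
    (hg : ∀ ℓ, G ℓ = μ.withDensity fun t => (g ℓ t : ℝ≥0∞))
    (hA : MemHInf μ A) (hQ : MemHInfPos μ Q) (k : ℕ) :
    MemHInfPos μ ((opT μ g A)^[k] Q) := by
  induction k with
  | zero => exact hQ
  | succ k ih => rw [Function.iterate_succ_apply']; exact ih.opT hG hg_meas hg hA

lemma costStep_iterate_formCost (hG : ∀ ℓ, G ℓ ≪ μ) (hg_meas : ∀ ℓ, Measurable (g ℓ))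
    (hg : ∀ ℓ, G ℓ = μ.withDensity fun t => (g ℓ t : ℝ≥0∞))
    (hA : MemHInf μ A) (hQ : MemHInfPos μ Q) (k : ℕ) :
    (costStep G A)^[k] (formCost Q) = formCost ((opT μ g A)^[k] Q) := by
  induction k with
  | zero => rfl
  | succ k ih =>
    rw [Function.iterate_succ_apply', ih, Function.iterate_succ_apply']
    funext ℓ x
    exact costStep_formCost hG hg_meas hg (memHInfPos_opT_iterate hG hg_meas hg hA hQ k) ℓ x

/-- If the matrix functions `V k` are dominated entrywise by a summable sequence of constants, then
`opT` may be applied to the series `∑ V k` term by term. -/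
lemma hasSum_opT (hG : ∀ ℓ, G ℓ ≪ μ) (hg_meas : ∀ ℓ, Measurable (g ℓ))
    (hg : ∀ ℓ, G ℓ = μ.withDensity fun t => (g ℓ t : ℝ≥0∞))
    {V : ℕ → Θ → Matrix (Fin n) (Fin n) ℝ} (hV : ∀ k, MemHInf μ (V k)) {b : ℕ → ℝ}
    (hb : Summable b) (hVb : ∀ᵐ ℓ ∂μ, ∀ k i j, |V k ℓ i j| ≤ b k) (ℓ : Θ) (i j : Fin n) :
    HasSum (fun k => opT μ g A (V k) ℓ i j)
      (opT μ g A (fun ℓ => Matrix.of fun i j => ∑' k, V k ℓ i j) ℓ i j) := by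
  have hE : ∀ i j, HasSum (fun k => opE μ g (V k) ℓ i j)
      (opE μ g (fun ℓ => Matrix.of fun i j => ∑' k, V k ℓ i j) ℓ i j) := by
    intro i j
    simp only [opE_apply_eq_integral hg_meas hg, Matrix.of_apply]
    refine hasSum_integral_of_summable_integral_norm
      (fun k => (hV k).integrable_entry hG ℓ i j) (hb.of_nonneg_of_le (fun k => ?_) fun k => ?_)
    · exact integral_nonneg fun t => norm_nonneg _
    · calc ∫ t, ‖V k t i j‖ ∂(G ℓ) ≤ ∫ _, b k ∂(G ℓ) := by
            refine integral_mono_ae ((hV k).integrable_entry hG ℓ i j).norm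
              (integrable_const _) ?_
            filter_upwards [(hG ℓ).ae_le hVb] with t ht using ht k i j
        _ = b k := by simp
  simp only [opT, Matrix.mul_apply]
  exact hasSum_sum fun a _ => (hasSum_sum fun c _ => (hE c a).mul_left _).mul_right _

/-- If the iterates `(opT μ g A)^[k] Q` are dominated entrywise by a summable sequence, their sum
solves the Lyapunov equation with right-hand side `Q`. -/
lemma exists_solution_of_summable (hG : ∀ ℓ, G ℓ ≪ μ) (hg_meas : ∀ ℓ, Measurable (g ℓ))
    (hg : ∀ ℓ, G ℓ = μ.withDensity fun t => (g ℓ t : ℝ≥0∞))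
    (hA : MemHInf μ A) (hQ : MemHInfPos μ Q) {b : ℕ → ℝ}
    (hb : Summable b) (hQb : ∀ᵐ ℓ ∂μ, ∀ k i j, |(opT μ g A)^[k] Q ℓ i j| ≤ b k) :
    ∃ U, MemHInfPos μ U ∧ ∀ᵐ ℓ ∂μ, U ℓ - opT μ g A U ℓ = Q ℓ := by
  have hV := memHInfPos_opT_iterate hG hg_meas hg hA hQ
  set V : ℕ → Θ → Matrix (Fin n) (Fin n) ℝ := fun k => (opT μ g A)^[k] Q with hVdef
  have hsum : ∀ᵐ ℓ ∂μ, ∀ i j, Summable fun k => V k ℓ i j := by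
    filter_upwards [hQb] with ℓ hℓ i j
    exact Summable.of_norm_bounded (f := fun k => V k ℓ i j) hb fun k => hℓ k i j
  have hsymm : ∀ ℓ, (Matrix.of fun i j => ∑' k, V k ℓ i j).IsSymm := by
    intro ℓ
    ext i j
    simp only [Matrix.transpose_apply, Matrix.of_apply]
    exact tsum_congr fun k => ((hV k).2.1 ℓ).apply i j
  refine ⟨fun ℓ => Matrix.of fun i j => ∑' k, V k ℓ i j, ⟨?_, hsymm, ?_⟩, ?_⟩
  · refine memHInf_of_entry_le (K := ∑' k, b k) (fun i j => ?_) ?_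
    · exact Measurable.tsum fun k => (hV k).1.1 i j
    · filter_upwards [hQb] with ℓ hℓ i j
      exact tsum_of_norm_bounded (f := fun k => V k ℓ i j) hb.hasSum fun k => hℓ k i j
  · filter_upwards [hsum, ae_all_iff.2 fun k => (hV k).2.2] with ℓ hℓ hpos
    refine .of_dotProduct_mulVec_nonneg ?_ fun x => ?_
    · rw [Matrix.IsHermitian, Matrix.conjTranspose_eq_transpose_of_trivial]
      exact hsymm ℓ
    · have hx : HasSum (fun k => x ⬝ᵥ V k ℓ *ᵥ x)
          (x ⬝ᵥ (Matrix.of fun i j => ∑' k, V k ℓ i j) *ᵥ x) := by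
        simp only [dotProduct, Matrix.mulVec, Matrix.of_apply]
        exact hasSum_sum fun i _ =>
          (hasSum_sum fun j _ => (hℓ i j).hasSum.mul_right _).mul_left _
      rw [star_trivial]
      exact hx.nonneg fun k => by simpa using (hpos k).dotProduct_mulVec_nonneg x
  · filter_upwards [hsum] with ℓ hℓ
    ext i j
    have h1 : HasSum (fun k => V (k + 1) ℓ i j)
        (opT μ g A (fun ℓ => Matrix.of fun i j => ∑' k, V k ℓ i j) ℓ i j) := by
      have h2 : (fun k => V (k + 1) ℓ i j) = fun k => opT μ g A (V k) ℓ i j := by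
        funext k
        exact congrFun₂ (congrFun (Function.iterate_succ_apply' (opT μ g A) k Q) ℓ) i j
      rw [h2]
      exact hasSum_opT hG hg_meas hg (fun k => (hV k).1) hb hQb ℓ i j
    rw [Matrix.sub_apply, ← h1.tsum_eq, Matrix.of_apply, (hℓ i j).tsum_eq_zero_add]
    exact add_sub_cancel_right _ _

end Sum

/-- For a stable system the Lyapunov equation with right-hand side `Q` is solved by the series of
the iterates of `opT` on `Q`: on quadratic forms the iterates are expected costs, which decay
geometrically. -/
theorem exists_solution_of_isEMSS {Θ : Type u} [MeasurableSpace Θ] {μ : Measure Θ} [SigmaFinite μ]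
    {n : ℕ} {G : Kernel Θ Θ} [IsMarkovKernel G] {g : Θ → Θ → ℝ≥0}
    (hG : ∀ ℓ, G ℓ ≪ μ) (hg_meas : ∀ ℓ, Measurable (g ℓ))
    (hg : ∀ ℓ, G ℓ = μ.withDensity fun t => (g ℓ t : ℝ≥0∞))
    {A Q : Θ → Matrix (Fin n) (Fin n) ℝ} (hA : MemHInf μ A) (hQ : MemHInfPos μ Q)
    (h : IsEMSS μ G A) : ∃ U, MemHInfPos μ U ∧ ∀ᵐ ℓ ∂μ, U ℓ - opT μ g A U ℓ = Q ℓ := by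
  obtain ⟨M, α, hM, hα0, hα1, hMα⟩ := (isEMSS_iff hA.1).1 h
  obtain ⟨K, hK0, hK⟩ := hQ.1.exists_formCost_bound
  have hV := memHInfPos_opT_iterate hG hg_meas hg hA hQ
  refine exists_solution_of_summable hG hg_meas hg hA hQ (b := fun k => K * (M * α ^ k))
    (((summable_geometric_of_lt_one hα0.le hα1).mul_left M).mul_left K) ?_
  refine ae_all_iff.2 fun k => ?_
  filter_upwards [costStep_iterate_mono (A := A) hG hK k, hMα k, (hV k).2.2] with ℓ h1 h2 hpos i j
  refine abs_entry_le_of_form_le hpos (fun x => ?_) i j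
  have hx := zero_le_dotProduct_self x
  have h3 := h1 x
  rw [costStep_iterate_const_mul ENNReal.ofReal_ne_top,
    costStep_iterate_formCost hG hg_meas hg hA hQ] at h3
  have h4 := h3.trans (mul_le_mul_right (h2 x) _)
  simp only [sqCost, formCost] at h4
  rw [← ENNReal.ofReal_mul (by positivity), ← ENNReal.ofReal_mul (by positivity),
    ENNReal.ofReal_le_ofReal_iff (by positivity), ← mul_assoc] at h4
  exact h4

/-! ### Lyapunov functions -/

section Lyapunov

variable {Θ : Type u} [MeasurableSpace Θ] {μ : Measure Θ} [SigmaFinite μ] {n : ℕ}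
  {G : Kernel Θ Θ} [IsMarkovKernel G] {A : Θ → Matrix (Fin n) (Fin n) ℝ}

/-- A cost comparable to `‖x‖²` that decreases in one step by a fixed multiple of `‖x‖²` proves
exponential mean-square stability. -/
theorem isEMSS_of_lyapunov (hG : ∀ ℓ, G ℓ ≪ μ) (hA : ∀ i j, Measurable fun ℓ => A ℓ i j)
    {w : Θ → (Fin n → ℝ) → ℝ≥0∞} {W δ : ℝ} (hδ : 0 < δ)
    (hlow : ∀ᵐ ℓ ∂μ, ∀ x, sqCost ℓ x ≤ w ℓ x)
    (hup : ∀ᵐ ℓ ∂μ, ∀ x, w ℓ x ≤ ENNReal.ofReal W * sqCost ℓ x)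
    (hdec : ∀ᵐ ℓ ∂μ, ∀ x, costStep G A w ℓ x + ENNReal.ofReal δ * sqCost ℓ x ≤ w ℓ x) :
    IsEMSS μ G A := by
  -- The contraction factor is `1 - η`; enlarging `W` keeps `η` strictly between `0` and `1`.
  obtain ⟨V, hWV, hV0, hVδ⟩ : ∃ V, W ≤ V ∧ 0 < V ∧ δ < V :=
    ⟨max W δ + 1, by linarith [le_max_left W δ], by linarith [le_max_right W δ],
      by linarith [le_max_right W δ]⟩
  set η : ℝ := δ / V with hη
  have hη0 : 0 < η := by positivity
  have hη1 : η < 1 := (div_lt_one hV0).2 hVδ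
  have hup' : ∀ᵐ ℓ ∂μ, ∀ x, w ℓ x ≤ ENNReal.ofReal V * sqCost ℓ x := by
    filter_upwards [hup] with ℓ hℓ x
    exact (hℓ x).trans (by gcongr)
  have hcontr : ∀ᵐ ℓ ∂μ, ∀ x, costStep G A w ℓ x ≤ ENNReal.ofReal (1 - η) * w ℓ x := by
    filter_upwards [hup', hdec] with ℓ h1 h2 x
    have hfin : w ℓ x ≠ ∞ := ((h1 x).trans_lt
      (ENNReal.mul_lt_top ENNReal.ofReal_lt_top ENNReal.ofReal_lt_top)).ne
    refine (ENNReal.add_le_add_iff_right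
      (ENNReal.mul_ne_top (ENNReal.ofReal_ne_top (r := η)) hfin)).1 ?_
    calc costStep G A w ℓ x + ENNReal.ofReal η * w ℓ x
        ≤ costStep G A w ℓ x + ENNReal.ofReal η * (ENNReal.ofReal V * sqCost ℓ x) := by
          gcongr; exact h1 x
      _ = costStep G A w ℓ x + ENNReal.ofReal δ * sqCost ℓ x := by
          rw [← mul_assoc, ← ENNReal.ofReal_mul hη0.le, hη, div_mul_cancel₀ _ hV0.ne']
      _ ≤ w ℓ x := h2 x
      _ = ENNReal.ofReal (1 - η) * w ℓ x + ENNReal.ofReal η * w ℓ x := by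
          rw [← add_mul, ← ENNReal.ofReal_add (by linarith) hη0.le, sub_add_cancel,
            ENNReal.ofReal_one, one_mul]
  refine (isEMSS_iff hA).2 ⟨V, 1 - η, hV0.le, by linarith, by linarith, fun k => ?_⟩
  filter_upwards [costStep_iterate_mono (A := A) hG hlow k,
    costStep_iterate_le_of_contraction hG ENNReal.ofReal_ne_top hcontr k, hup'] with ℓ h1 h2 h3 x
  calc _ ≤ ENNReal.ofReal (1 - η) ^ k * w ℓ x := (h1 x).trans (h2 x)
    _ ≤ ENNReal.ofReal (1 - η) ^ k * (ENNReal.ofReal V * sqCost ℓ x) := by gcongr; exact h3 x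
    _ = _ := by
      rw [ENNReal.ofReal_mul hV0.le, ENNReal.ofReal_pow (by linarith)]
      ring

/-- For a stable system the expected total cost `∑ E‖x(k)‖²` is a Lyapunov function. -/
theorem exists_lyapunov_of_isEMSS (hA : ∀ i j, Measurable fun ℓ => A ℓ i j) (h : IsEMSS μ G A) :
    ∃ (p : Θ → (Fin n → ℝ) → ℝ≥0∞) (M : ℝ), 0 < M ∧ Measurable (Function.uncurry p) ∧
      (∀ ℓ, IsQuadLike (p ℓ)) ∧ (∀ ℓ x, p ℓ x = sqCost ℓ x + costStep G A p ℓ x) ∧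
      ∀ᵐ ℓ ∂μ, ∀ x, p ℓ x ≤ ENNReal.ofReal M * sqCost ℓ x := by
  obtain ⟨M, α, hM, hα0, hα1, hMα⟩ := (isEMSS_iff hA).1 h
  have hm := measurable_costStep_iterate (G := G) hA (measurable_sqCost (Θ := Θ))
  have hs : Summable fun k => M * α ^ k := (summable_geometric_of_lt_one hα0.le hα1).mul_left M
  refine ⟨fun ℓ x => ∑' k, (costStep G A)^[k] sqCost ℓ x, (∑' k, M * α ^ k) + 1,
    add_pos_of_nonneg_of_pos (tsum_nonneg fun k => by positivity) one_pos, ?_,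
    fun ℓ => .tsum fun k => isQuadLike_costStep_iterate hA k ℓ, fun ℓ x => ?_, ?_⟩
  · exact Measurable.tsum hm
  · rw [costStep_tsum hm]
    simp only [← Function.iterate_succ_apply' (costStep G A)]
    exact tsum_eq_zero_add' ENNReal.summable
  · filter_upwards [ae_all_iff.2 hMα] with ℓ hℓ x
    calc _ ≤ ∑' k, ENNReal.ofReal (M * α ^ k) * sqCost ℓ x :=
          ENNReal.tsum_le_tsum fun k => hℓ k x
      _ = ENNReal.ofReal (∑' k, M * α ^ k) * sqCost ℓ x := by
          rw [ENNReal.tsum_mul_right, ENNReal.ofReal_tsum_of_nonneg (fun k => by positivity) hs]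
      _ ≤ _ := by gcongr; linarith

end Lyapunov

/-! ### A solution of the Lyapunov equation gives stability -/

/-- A positive semidefinite solution of `U - opT U = CᵀC`, seen as an identity between the cost of
`U`, the output `‖C x‖²` and the expected cost after one step. -/
lemma formCost_eq_output_add_costStep {Θ : Type*} [MeasurableSpace Θ] {μ : Measure Θ} {n p : ℕ}
    {G : Kernel Θ Θ} [IsMarkovKernel G] {g : Θ → Θ → ℝ≥0} (hG : ∀ ℓ, G ℓ ≪ μ)
    (hg_meas : ∀ ℓ, Measurable (g ℓ)) (hg : ∀ ℓ, G ℓ = μ.withDensity fun t => (g ℓ t : ℝ≥0∞))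
    {A U : Θ → Matrix (Fin n) (Fin n) ℝ} {C : Θ → Matrix (Fin p) (Fin n) ℝ} (hA : MemHInf μ A)
    (hU : MemHInfPos μ U) (hUC : ∀ᵐ ℓ ∂μ, U ℓ - opT μ g A U ℓ = (C ℓ)ᵀ * C ℓ) :
    ∀ᵐ ℓ ∂μ, ∀ x, formCost U ℓ x
      = ENNReal.ofReal ((C ℓ *ᵥ x) ⬝ᵥ (C ℓ *ᵥ x)) + costStep G A (formCost U) ℓ x := by
  filter_upwards [hUC, (hU.opT hG hg_meas hg hA).2.2] with ℓ h1 h2 x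
  have h3 : 0 ≤ x ⬝ᵥ opT μ g A U ℓ *ᵥ x := by simpa using h2.dotProduct_mulVec_nonneg x
  rw [costStep_formCost hG hg_meas hg hU]
  simp only [formCost]
  rw [← ENNReal.ofReal_add (zero_le_dotProduct_self _) h3, sub_eq_iff_eq_add.1 h1,
    Matrix.add_mulVec, dotProduct_add, ← Matrix.mulVec_mulVec, Matrix.dotProduct_mulVec,
    Matrix.vecMul_transpose]

/-- A Lyapunov function `p` of the closed loop `A + HC` decreases along the open loop up to a
multiple of the output: the open loop is the closed loop with the input `-H C x`. -/
lemma costStep_le_add_output {Θ : Type*} [MeasurableSpace Θ] {μ : Measure Θ} {n m : ℕ}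
    {G : Kernel Θ Θ} [IsMarkovKernel G] (hG : ∀ ℓ, G ℓ ≪ μ) {A : Θ → Matrix (Fin n) (Fin n) ℝ}
    {H : Θ → Matrix (Fin n) (Fin m) ℝ} {C : Θ → Matrix (Fin m) (Fin n) ℝ} (hH : MemHInf μ H)
    {p : Θ → (Fin n → ℝ) → ℝ≥0∞} (hpm : Measurable (Function.uncurry p))
    (hpq : ∀ ℓ, IsQuadLike (p ℓ)) {M : ℝ}
    (hpM : ∀ᵐ ℓ ∂μ, ∀ x, p ℓ x ≤ ENNReal.ofReal M * sqCost ℓ x) {ε : ℝ} (hε : 0 < ε) :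
    ∃ K : ℝ, 0 ≤ K ∧ ∀ᵐ ℓ ∂μ, ∀ x, costStep G A p ℓ x
      ≤ ENNReal.ofReal (1 + ε) * costStep G (fun ℓ => A ℓ + H ℓ * C ℓ) p ℓ x
        + ENNReal.ofReal K * ENNReal.ofReal ((C ℓ *ᵥ x) ⬝ᵥ (C ℓ *ᵥ x)) := by
  obtain ⟨L, hL0, hL⟩ := hH.exists_sqCost_bound
  refine ⟨(1 + ε⁻¹) * (max M 0 * L), by positivity, ?_⟩
  filter_upwards [hL] with ℓ hℓ x
  set y := (A ℓ + H ℓ * C ℓ) *ᵥ x with hy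
  set z := -(H ℓ *ᵥ (C ℓ *ᵥ x)) with hz
  have hyz : A ℓ *ᵥ x = y + z := by
    rw [hy, hz, Matrix.add_mulVec, Matrix.mulVec_mulVec, add_neg_cancel_right]
  have hzz : z ⬝ᵥ z = (H ℓ *ᵥ (C ℓ *ᵥ x)) ⬝ᵥ (H ℓ *ᵥ (C ℓ *ᵥ x)) := by
    rw [hz, neg_dotProduct, dotProduct_neg, neg_neg]
  have hpz : ∫⁻ t, p t z ∂(G ℓ) ≤ ENNReal.ofReal M *
      (ENNReal.ofReal L * ENNReal.ofReal ((C ℓ *ᵥ x) ⬝ᵥ (C ℓ *ᵥ x))) := by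
    calc ∫⁻ t, p t z ∂(G ℓ) ≤ ∫⁻ _, ENNReal.ofReal M * ENNReal.ofReal (z ⬝ᵥ z) ∂(G ℓ) := by
          refine lintegral_mono_ae ?_
          filter_upwards [(hG ℓ).ae_le hpM] with t ht using ht z
      _ = ENNReal.ofReal M * ENNReal.ofReal (z ⬝ᵥ z) := by simp
      _ ≤ _ := by
          rw [hzz]
          gcongr
          exact hℓ _
  calc costStep G A p ℓ x = ∫⁻ t, p t (y + z) ∂(G ℓ) := by simp only [costStep, hyz]
    _ ≤ ∫⁻ t, ENNReal.ofReal (1 + ε) * p t y + ENNReal.ofReal (1 + ε⁻¹) * p t z ∂(G ℓ) :=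
        lintegral_mono fun t => (hpq t).add_le ε hε y z
    _ = ENNReal.ofReal (1 + ε) * ∫⁻ t, p t y ∂(G ℓ)
          + ENNReal.ofReal (1 + ε⁻¹) * ∫⁻ t, p t z ∂(G ℓ) := by
        rw [lintegral_add_left (Measurable.const_mul (f := fun t => p t y)
          (hpm.comp measurable_prodMk_right) _), lintegral_const_mul' _ _ ENNReal.ofReal_ne_top,
          lintegral_const_mul' _ _ ENNReal.ofReal_ne_top]
    _ ≤ _ := by
        refine add_le_add le_rfl ?_
        rw [ENNReal.ofReal_mul (by positivity), ENNReal.ofReal_mul (by positivity), mul_assoc,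
          mul_assoc]
        gcongr
        refine hpz.trans ?_
        gcongr
        exact le_max_left _ _

/-- A positive semidefinite solution of the Lyapunov equation proves stability of a detectable
system. The Lyapunov function is `p + K U`, where `p` is a Lyapunov function of the closed loop
`A + HC`: along the open loop, `p` decreases up to a multiple of `‖C x‖²`, which is exactly the
decrease of `U`. -/
theorem isEMSS_of_solution {Θ : Type u} [MeasurableSpace Θ] {μ : Measure Θ} [SigmaFinite μ]
    {n m : ℕ} {G : Kernel Θ Θ} [IsMarkovKernel G] {g : Θ → Θ → ℝ≥0} (hG : ∀ ℓ, G ℓ ≪ μ)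
    (hg_meas : ∀ ℓ, Measurable (g ℓ)) (hg : ∀ ℓ, G ℓ = μ.withDensity fun t => (g ℓ t : ℝ≥0∞))
    {A U : Θ → Matrix (Fin n) (Fin n) ℝ} {C : Θ → Matrix (Fin m) (Fin n) ℝ} (hA : MemHInf μ A)
    (hC : MemHInf μ C) (hdet : IsDetectable μ G A C) (hU : MemHInfPos μ U)
    (hUC : ∀ᵐ ℓ ∂μ, U ℓ - opT μ g A U ℓ = (C ℓ)ᵀ * C ℓ) : IsEMSS μ G A := by
  obtain ⟨H, hH, hstab⟩ := hdet
  have hAc : ∀ i j, Measurable fun ℓ => (A ℓ + H ℓ * C ℓ) i j := by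
    intro i j
    simp only [Matrix.add_apply, Matrix.mul_apply]
    exact (hA.1 i j).add (Finset.measurable_sum _ fun k _ => (hH.1 i k).mul (hC.1 k j))
  obtain ⟨p, M, hM, hpm, hpq, hp, hpM⟩ := exists_lyapunov_of_isEMSS hAc hstab
  -- With `ε = 1 / M` the loss `ε p` is at most `‖x‖²`.
  obtain ⟨K, hK0, hK⟩ := costStep_le_add_output (A := A) (C := C) hG hH hpm hpq hpM (inv_pos.2 hM)
  obtain ⟨L, hL0, hL⟩ := hU.1.exists_formCost_bound
  refine isEMSS_of_lyapunov hG hA.1 (w := fun ℓ x => p ℓ x + ENNReal.ofReal K * formCost U ℓ x)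
    (W := M + K * L) (inv_pos.2 hM) (.of_forall fun ℓ x => ?_) ?_ ?_
  · rw [hp, add_assoc]
    exact le_self_add
  · filter_upwards [hpM, hL] with ℓ h1 h2 x
    rw [ENNReal.ofReal_add hM.le (by positivity), ENNReal.ofReal_mul hK0, add_mul, mul_assoc]
    gcongr
    exacts [h1 x, h2 x]
  · filter_upwards [hK, hpM, formCost_eq_output_add_costStep hG hg_meas hg hA hU hUC]
      with ℓ h1 h2 h3 x
    rw [costStep_add hpm, costStep_const_mul ENNReal.ofReal_ne_top]
    -- `q` is finite, so it suffices to prove the inequality with `q` added on both sides.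
    set q := sqCost ℓ x
    set c := ENNReal.ofReal ((C ℓ *ᵥ x) ⬝ᵥ (C ℓ *ᵥ x))
    set k := ENNReal.ofReal K
    set s := costStep G (fun ℓ => A ℓ + H ℓ * C ℓ) p ℓ x
    set r := costStep G A (formCost U) ℓ x
    set e := ENNReal.ofReal M⁻¹ with he
    have hq : q ≠ ∞ := ENNReal.ofReal_ne_top
    have h4 : ENNReal.ofReal (1 + M⁻¹) = 1 + e := by
      rw [ENNReal.ofReal_add zero_le_one (inv_pos.2 hM).le, ENNReal.ofReal_one]
    have h5 : e * p ℓ x ≤ q := by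
      calc e * p ℓ x ≤ e * (ENNReal.ofReal M * q) := by gcongr; exact h2 x
        _ = q := by
          rw [← mul_assoc, he, ← ENNReal.ofReal_mul (inv_pos.2 hM).le, inv_mul_cancel₀ hM.ne',
            ENNReal.ofReal_one, one_mul]
    have h6 := h1 x
    rw [h4] at h6
    refine (ENNReal.add_le_add_iff_right hq).1 ?_
    calc costStep G A p ℓ x + k * r + e * q + q
        ≤ (1 + e) * s + k * c + k * r + e * q + q := by gcongr
      _ = (q + s) + e * (q + s) + k * (c + r) := by ring
      _ = p ℓ x + e * p ℓ x + k * formCost U ℓ x := by rw [← hp, ← h3 x]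
      _ ≤ p ℓ x + q + k * formCost U ℓ x := by gcongr
      _ = p ℓ x + k * formCost U ℓ x + q := by ring

end MJLS

theorem theorem3 {Θ : Type*} [MeasurableSpace Θ] [StandardBorelSpace Θ]
    (μ : Measure Θ) [SigmaFinite μ]
    (G : Kernel Θ Θ) [IsMarkovKernel G]
    (g : Θ → Θ → ℝ≥0) (hg_meas : ∀ ℓ, Measurable (g ℓ))
    (hg : ∀ ℓ, G ℓ = μ.withDensity (fun t => (g ℓ t : ℝ≥0∞)))
    {n p : ℕ}
    (A : Θ → Matrix (Fin n) (Fin n) ℝ) (hA : MJLS.MemHInf μ A)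
    (C : Θ → Matrix (Fin p) (Fin n) ℝ) (hC : MJLS.MemHInf μ C)
    (hdet : MJLS.IsDetectable μ G A C) :
    MJLS.IsEMSS μ G A ↔
      ∃ U : Θ → Matrix (Fin n) (Fin n) ℝ, MJLS.MemHInfPos μ U ∧
        ∀ᵐ ℓ ∂μ, U ℓ - MJLS.opT μ g A U ℓ = (C ℓ)ᵀ * C ℓ := by
  have hG : ∀ ℓ, G ℓ ≪ μ := fun ℓ => hg ℓ ▸ withDensity_absolutelyContinuous _ _
  constructor
  · exact MJLS.exists_solution_of_isEMSS hG hg_meas hg hA (MJLS.memHInfPos_transpose_mul_self hC)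
  · rintro ⟨U, hU, hUC⟩
    exact MJLS.isEMSS_of_solution hG hg_meas hg hA hC hdet hU hUC
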